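/- Let $n\ge 0$ and let $S_n$ be the symmetric group on $\{1,\dots,n\}$, with $\ell(w)=\#\{(i,j): i<j,\ w(i)>w(j)\}$ the length of $w\in S_n$. Let $\le$ be the Bruhat order on $S_n$: $u\le v$ if and only if there are transpositions $t_1,\dots,t_k$ ($k\ge 0$) with $v=ut_1\cdots t_k$ and $\ell(ut_1\cdots t_{r-1})<\ell(ut_1\cdots t_r)$ for $r=1,\dots,k$; write $u<v$ if $u\le v$ and $u\ne v$. For $w\in S_n$ and $(i,j)\in\{0,\dots,n\}^2$ let $$\mathrm{rk}_w(i,j)=\#\{u\in\{1,\dots,i\}: w(u)\le j\}.$$ Let $w,x\in S_n$ with $x\le w$. The pair $(w,x)$ is called smooth if $$\#\{t\in S_n \text{ a transposition}: x<xt\le w\}=\ell(w)-\ell(x),$$ and tight if every $y\in S_n$ such that $\mathrm{rk}_y(p)=\mathrm{rk}_w(p)$ for all $p\in\{0,\dots,n\}^2$ with $\mathrm{rk}_x(p)=\mathrm{rk}_w(p)$ satisfies $y\le w$. **Theorem.** Every smooth pair $(w,x)$ with $x\le w$ is tight. -/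

import Mathlib

namespace SchubertTight

variable {n : ℕ}

/-- The length `ℓ(w)` of a permutation: its number of inversions. Here `S_n` is
`Equiv.Perm (Fin n)`, with `{1, …, n}` shifted to `{0, …, n - 1}`. -/
def length (w : Equiv.Perm (Fin n)) : ℕ :=
  Fintype.card {p : Fin n × Fin n // p.1 < p.2 ∧ w p.2 < w p.1}

/-- One step of the Bruhat order: `v = u t` for a transposition `t`, and `ℓ(u) < ℓ(v)`. -/
def BruhatStep (u v : Equiv.Perm (Fin n)) : Prop :=
  (∃ t : Equiv.Perm (Fin n), t.IsSwap ∧ v = u * t) ∧ length u < length v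

/-- The Bruhat order `u ≤ v` on `S_n`: there is a (possibly empty) chain of Bruhat steps
from `u` to `v`. -/
def BruhatLE (u v : Equiv.Perm (Fin n)) : Prop :=
  Relation.ReflTransGen BruhatStep u v

/-- The strict Bruhat order `u < v`. -/
def BruhatLT (u v : Equiv.Perm (Fin n)) : Prop :=
  BruhatLE u v ∧ u ≠ v

/-- The framed square `{0, …, n} × {0, …, n}`. -/
abbrev FramedSquare (n : ℕ) : Type := Fin (n + 1) × Fin (n + 1)

/-- The rank function `rk_w(i, j) = #{u = 1, …, i : w(u) ≤ j}`. In zero-based indexing the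
conditions `u ≤ i` and `w(u) ≤ j` read `u < i` and `w u < j`. -/
def rk (w : Equiv.Perm (Fin n)) (p : FramedSquare n) : ℕ :=
  Fintype.card {u : Fin n // (u : ℕ) < (p.1 : ℕ) ∧ (w u : ℕ) < (p.2 : ℕ)}

/-- The level set of the pair `(w, x)`: the points of the framed square at which
`rk_x = rk_w`. -/
def levelSet (w x : Equiv.Perm (Fin n)) : Set (FramedSquare n) :=
  {p | rk x p = rk w p}

/-- The set of transpositions `t` such that `x < x t ≤ w`. -/
def reflectionSet (w x : Equiv.Perm (Fin n)) : Set (Equiv.Perm (Fin n)) :=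
  {t | t.IsSwap ∧ BruhatLT x (x * t) ∧ BruhatLE (x * t) w}

/-- The pair `(w, x)` is smooth: `#{t : x < x t ≤ w} = ℓ(w) - ℓ(x)` (as integers). -/
def IsSmoothPair (w x : Equiv.Perm (Fin n)) : Prop :=
  ((reflectionSet w x).ncard : ℤ) = (length w : ℤ) - (length x : ℤ)

/-- A subset `A` of the framed square is tight with respect to `w`: every `y ∈ S_n` whose rank
function agrees with that of `w` on `A` satisfies `y ≤ w`. -/
def IsTightSet (w : Equiv.Perm (Fin n)) (A : Set (FramedSquare n)) : Prop :=
  ∀ y : Equiv.Perm (Fin n), (∀ p ∈ A, rk y p = rk w p) → BruhatLE y w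

/-- The pair `(w, x)` is tight: its level set is tight with respect to `w`. -/
def IsTightPair (w x : Equiv.Perm (Fin n)) : Prop :=
  IsTightSet w (levelSet w x)

end SchubertTight

/-! By the rank criterion (`RankLE.bruhatLE`, `BruhatLE.rankLE`), `y ≤ w` means that the ranks of
`y` dominate those of `w`. Exchanging non-inverted rows of `x` lowers its rank by one exactly on the
rectangle they span, so the reflections of a pair are the rectangles on which `rk_x > rk_w`. Let `r`
be the first row where `x` and `w` differ. Some cover of `x` in row `r` stays below `w`, and it
loses at least one reflection (`RowCover.card_reflPairs_lt`). This gives Deodhar's inequality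
(`card_reflPairs_lower_bound`) and passes smoothness on to the cover (`RankSmooth.of_rowCover`).

Tightness follows by induction along these covers. If `y` has the ranks of `w` on the level set of
`x`, then it agrees with `w` above row `r`, and `x r ≤ y r ≤ w r`. Raising row `r` of `y` to `w r`
keeps the ranks on the level set (`RankSmooth.exists_raised`). The raised permutation also has the
right ranks at the points that the cover adds to the level set (`RankSmooth.rkN_eq_of_mem_cover`),
so induction puts it below `w`, and `y` with it.

Both steps rest on a rigidity in row `r`. Deodhar's inequality for a lowering of `w` bounds the
reflections in row `r` by the number of records (`RankSmooth.card_row_le`). Counting points of `x`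
and `w` above the staircase `cut`, cut out by the level set, gives the opposite bound. Equality
throughout (`RankSmooth.staircase`) makes "points above the staircase plus rank" the same for `y` as
for `w` (`RankSmooth.stair_add_rkN_eq`). -/

namespace SchubertTight

open Finset Equiv

/-! ### Rank functions, lengths, and the effect of an exchange of rows. -/

section Ranks

variable {n : ℕ}

/-- The number of rows `u < a` of `z` with value `< c`, for arbitrary natural numbers `a`, `c`. -/
def rkN (z : Perm (Fin n)) (a c : ℕ) : ℕ :=
  #{u : Fin n | (u : ℕ) < a ∧ (z u : ℕ) < c}

/-- The number of rows `u < a` of `z` with value in `[c, d)`. -/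
def band (z : Perm (Fin n)) (a c d : ℕ) : ℕ :=
  #{u : Fin n | (u : ℕ) < a ∧ c ≤ (z u : ℕ) ∧ (z u : ℕ) < d}

theorem card_filter_le_of_imp {α : Type*} [Fintype α] {P Q : α → Prop} [DecidablePred P]
    [DecidablePred Q] (h : ∀ u, P u → Q u) :
    #{u | P u} ≤ #{u | Q u} :=
  card_le_card fun u hu => by simpa using h u (by simpa using hu)

theorem card_filter_lt_of_imp {α : Type*} [Fintype α] [DecidableEq α] {P Q : α → Prop}
    [DecidablePred P] [DecidablePred Q] (h : ∀ u, P u → Q u) (v : α) (hv : Q v) (hv' : ¬ P v) :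
    #{u | P u} + 1 ≤ #{u | Q u} := by
  rw [← card_insert_of_notMem (s := {u | P u}) (a := v) (by simpa using hv')]
  refine card_le_card fun u hu => ?_
  simp only [mem_insert, mem_filter, mem_univ, true_and] at hu ⊢
  rcases hu with rfl | hu
  exacts [hv, h u hu]

theorem card_filter_add_two_le {α : Type*} [Fintype α] [DecidableEq α] {P Q : α → Prop}
    [DecidablePred P] [DecidablePred Q] (h : ∀ u, P u → Q u) (v v' : α) (hv : Q v) (hv' : Q v')
    (hP : ¬ P v) (hP' : ¬ P v') (hne : v ≠ v') :
    #{u | P u} + 2 ≤ #{u | Q u} := by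
  have h1 := card_filter_lt_of_imp (P := P) (Q := fun u => P u ∨ u = v) (fun u hu => Or.inl hu) v
    (Or.inr rfl) hP
  have h2 := card_filter_lt_of_imp (P := fun u => P u ∨ u = v) (Q := Q)
    (fun u hu => hu.elim (h u) (fun e => e ▸ hv)) v' hv' (by rintro (h | h); exacts [hP' h, hne h.symm])
  omega

theorem rkN_add_band (z : Perm (Fin n)) (a : ℕ) {c d : ℕ} (h : c ≤ d) :
    rkN z a c + band z a c d = rkN z a d := by
  unfold rkN band
  rw [← card_union_of_disjoint]
  · congr 1
    ext u
    simp only [mem_union, mem_filter, mem_univ, true_and]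
    omega
  · rw [disjoint_filter]
    intro u _ _
    omega

theorem rkN_of_row_ge (z : Perm (Fin n)) {a : ℕ} (ha : n ≤ a) (c : ℕ) :
    rkN z a c = #{v : Fin n | (v : ℕ) < c} := by
  unfold rkN
  refine card_bij (fun u _ => z u) ?_ ?_ ?_
  · intro u hu
    simpa using (by simpa using hu : _ ∧ _).2
  · intro u _ v _ h
    exact z.injective h
  · intro v hv
    refine ⟨z.symm v, ?_, by simp⟩
    have := (z.symm v).isLt
    simp only [mem_filter, mem_univ, true_and, apply_symm_apply] at hv ⊢
    exact ⟨by omega, hv⟩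

theorem rk_eq_rkN (z : Perm (Fin n)) (p : FramedSquare n) : rk z p = rkN z p.1 p.2 := by
  unfold rk rkN
  exact Fintype.card_subtype _

theorem rkN_min (z : Perm (Fin n)) (a c : ℕ) : rkN z a c = rkN z (min a n) (min c n) := by
  unfold rkN
  congr 1
  ext u
  have := (z u).isLt
  have := u.isLt
  simp only [mem_filter, mem_univ, true_and]
  omega

theorem rkN_eq_rk (z : Perm (Fin n)) (a c : ℕ) :
    rkN z a c = rk z (⟨min a n, by omega⟩, ⟨min c n, by omega⟩) := by
  rw [rk_eq_rkN, rkN_min]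

theorem rkN_congr {x w : Perm (Fin n)} {r a : ℕ} (h : ∀ u : Fin n, (u : ℕ) < r → x u = w u)
    (ha : a ≤ r) (c : ℕ) : rkN x a c = rkN w a c := by
  unfold rkN
  congr 1
  ext u
  simp only [mem_filter, mem_univ, true_and]
  constructor <;> rintro ⟨h1, h2⟩ <;> have := h u (by omega) <;> simp_all

theorem rkN_succ_col (z : Perm (Fin n)) (a : ℕ) (v : Fin n) :
    rkN z a (v + 1) = rkN z a v + if (z.symm v : ℕ) < a then 1 else 0 := by
  rw [← rkN_add_band z a (Nat.le_succ v)]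
  congr 1
  unfold band
  split_ifs with h
  · rw [card_eq_one]
    refine ⟨z.symm v, ?_⟩
    ext u
    simp only [mem_filter, mem_univ, true_and, mem_singleton, eq_symm_apply, Fin.ext_iff]
    constructor
    · omega
    · intro e
      have : u = z.symm v := by rw [eq_symm_apply]; exact Fin.ext e
      subst this
      exact ⟨h, by simp⟩
  · rw [card_eq_zero, filter_eq_empty_iff]
    rintro u - ⟨h1, h2, h3⟩
    have : u = z.symm v := by rw [eq_symm_apply]; exact Fin.ext (by omega)
    subst this
    exact h h1

theorem sum_eq_add_add_sum_erase {M : Type*} [AddCommMonoid M] {i j : Fin n} (hij : i ≠ j)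
    (f : Fin n → M) : ∑ u, f u = f i + (f j + ∑ u ∈ (univ.erase i).erase j, f u) := by
  rw [add_sum_erase _ f (by simp [hij.symm]), add_sum_erase _ f (mem_univ i)]

theorem rkN_eq_sum (z : Perm (Fin n)) (a c : ℕ) :
    rkN z a c = ∑ u : Fin n, if (u : ℕ) < a ∧ (z u : ℕ) < c then 1 else 0 := by
  unfold rkN
  rw [card_filter]

theorem mul_swap_apply_of_mem_erase (x : Perm (Fin n)) {i j u : Fin n}
    (hu : u ∈ (univ.erase i).erase j) : (x * swap i j) u = x u := by
  simp only [mem_erase, mem_univ, and_true] at hu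
  rw [Perm.mul_apply, swap_apply_of_ne_of_ne hu.2 hu.1]

/-- Only rows `i` and `j` contribute differently; an additive correction avoids truncated
subtraction. -/
theorem rkN_mul_swap (x : Perm (Fin n)) {i j : Fin n} (hij : i < j) (hx : x i < x j) (a c : ℕ) :
    rkN (x * swap i j) a c +
      (if ((i : ℕ) < a ∧ a ≤ j ∧ (x i : ℕ) < c ∧ c ≤ x j) then 1 else 0) = rkN x a c := by
  rw [rkN_eq_sum, rkN_eq_sum, sum_eq_add_add_sum_erase hij.ne,
    sum_eq_add_add_sum_erase hij.ne (fun u => if (u : ℕ) < a ∧ (x u : ℕ) < c then 1 else 0)]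
  rw [sum_congr rfl fun u hu => by rw [mul_swap_apply_of_mem_erase x hu]]
  simp only [Perm.mul_apply, swap_apply_left, swap_apply_right]
  rw [Fin.lt_def] at hij hx
  split_ifs <;> omega

theorem rkN_mul_swap_le (x : Perm (Fin n)) {i j : Fin n} (hij : i < j) (hx : x i < x j) (a c : ℕ) :
    rkN (x * swap i j) a c ≤ rkN x a c := by
  rw [← rkN_mul_swap x hij hx]
  exact Nat.le_add_right _ _

theorem rkN_mul_swap_of_mem (x : Perm (Fin n)) {i j : Fin n} (hij : i < j) (hx : x i < x j)
    {a c : ℕ} (h1 : (i : ℕ) < a) (h2 : a ≤ j) (h3 : (x i : ℕ) < c) (h4 : c ≤ x j) :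
    rkN (x * swap i j) a c + 1 = rkN x a c := by
  rw [← rkN_mul_swap x hij hx, if_pos ⟨h1, h2, h3, h4⟩]

theorem rkN_mul_swap_of_notMem (x : Perm (Fin n)) {i j : Fin n} (hij : i < j) (hx : x i < x j)
    {a c : ℕ} (h : ¬ ((i : ℕ) < a ∧ a ≤ j ∧ (x i : ℕ) < c ∧ c ≤ x j)) :
    rkN (x * swap i j) a c = rkN x a c := by
  rw [← rkN_mul_swap x hij hx, if_neg h, add_zero]

theorem length_eq_sum (z : Perm (Fin n)) :
    length z = ∑ p : Fin n, #{q : Fin n | p < q ∧ z q < z p} := by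
  unfold length
  rw [Fintype.card_subtype, card_filter, Fintype.sum_prod_type]
  exact sum_congr rfl fun p _ => (card_filter _ _).symm

/-- The value `z p` counts the rows with smaller value: those after `p` are inversions, those before
`p` are counted by the rank at `(p, z p)`. Hence length changes can be read off from rank changes.
-/
theorem length_add_sum (z : Perm (Fin n)) :
    length z + ∑ p : Fin n, rkN z p (z p) = ∑ p : Fin n, (p : ℕ) := by
  rw [length_eq_sum, ← sum_add_distrib,
    show ∑ p : Fin n, (p : ℕ) = ∑ p : Fin n, (z p : ℕ) from
      (Equiv.sum_comp z fun p : Fin n => (p : ℕ)).symm]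
  refine sum_congr rfl fun p _ => ?_
  have h := rkN_of_row_ge z le_rfl (z p : ℕ)
  have h' : #{v : Fin n | (v : ℕ) < (z p : ℕ)} = (z p : ℕ) := by
    have := Fin.card_Iio (z p)
    refine Eq.trans ?_ this
    congr 1
    ext v
    rw [mem_filter, mem_Iio, Fin.lt_def]
    simp only [mem_univ, true_and]
  rw [h'] at h
  refine Eq.trans ?_ h
  unfold rkN
  rw [← card_union_of_disjoint]
  · congr 1
    ext u
    simp only [mem_union, mem_filter, mem_univ, true_and, Fin.lt_def]
    have := u.isLt
    rcases lt_trichotomy (u : ℕ) p with h | h | h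
    · omega
    · have : u = p := Fin.ext h
      subst this
      simp
    · omega
  · rw [disjoint_filter]
    intro u _ h
    rw [Fin.lt_def] at h
    omega

/-- Effect on the length of exchanging two rows that are not inverted: the corrections count
the points in the rectangle they span. -/
theorem length_mul_swap (x : Perm (Fin n)) {i j : Fin n} (hij : i < j) (hx : x i < x j) :
    length (x * swap i j) = length x +
      #{u : Fin n | i ≤ u ∧ u < j ∧ x i ≤ x u ∧ x u < x j} +
      ∑ u ∈ (univ.erase i).erase j,
        (if ((i : ℕ) < (u : ℕ) ∧ (u : ℕ) ≤ j ∧ (x i : ℕ) < x u ∧ (x u : ℕ) ≤ x j) then 1 else 0) := by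
  have h1 := length_add_sum x
  have h2 := length_add_sum (x * swap i j)
  rw [sum_eq_add_add_sum_erase hij.ne] at h1 h2
  simp only [Perm.mul_apply, swap_apply_left, swap_apply_right] at h2
  have h3 : ∑ u ∈ (univ.erase i).erase j, rkN (x * swap i j) u (x (swap i j u)) +
      ∑ u ∈ (univ.erase i).erase j,
        (if ((i : ℕ) < (u : ℕ) ∧ (u : ℕ) ≤ j ∧ (x i : ℕ) < x u ∧ (x u : ℕ) ≤ x j) then 1 else 0) =
      ∑ u ∈ (univ.erase i).erase j, rkN x u (x u) := by
    rw [← sum_add_distrib]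
    refine sum_congr rfl fun u hu => ?_
    have := mul_swap_apply_of_mem_erase x hu
    rw [Perm.mul_apply] at this
    rw [this, rkN_mul_swap x hij hx]
  have h4 : rkN (x * swap i j) i (x j) = rkN x i (x j) :=
    rkN_mul_swap_of_notMem x hij hx (by omega)
  have h5 : rkN (x * swap i j) j (x i) = rkN x j (x i) :=
    rkN_mul_swap_of_notMem x hij hx (by omega)
  have h6 := rkN_add_band x i (le_of_lt (Fin.lt_def.1 hx))
  have h7 := rkN_add_band x j (le_of_lt (Fin.lt_def.1 hx))
  have h8 : band x j (x i) (x j) = band x i (x i) (x j) +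
      #{u : Fin n | i ≤ u ∧ u < j ∧ x i ≤ x u ∧ x u < x j} := by
    unfold band
    rw [← card_union_of_disjoint]
    · congr 1
      ext u
      simp only [mem_union, mem_filter, mem_univ, true_and, Fin.lt_def, Fin.le_def]
      rw [Fin.lt_def] at hij
      omega
    · rw [disjoint_filter]
      intro u _ _
      rw [Fin.le_def]
      omega
  omega

theorem length_lt_mul_swap (x : Perm (Fin n)) {i j : Fin n} (hij : i < j) (hx : x i < x j) :
    length x < length (x * swap i j) := by
  rw [length_mul_swap x hij hx]
  have : 0 < #{u : Fin n | i ≤ u ∧ u < j ∧ x i ≤ x u ∧ x u < x j} :=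
    card_pos.2 ⟨i, by simp [hij, hx]⟩
  omega

theorem length_mul_swap_of_cover (x : Perm (Fin n)) {i j : Fin n} (hij : i < j) (hx : x i < x j)
    (hc : ∀ u, i < u → u < j → x i < x u → x u < x j → False) :
    length (x * swap i j) = length x + 1 := by
  rw [length_mul_swap x hij hx]
  have h1 : #{u : Fin n | i ≤ u ∧ u < j ∧ x i ≤ x u ∧ x u < x j} = 1 := by
    rw [card_eq_one]
    refine ⟨i, ?_⟩
    ext u
    simp only [mem_filter, mem_univ, true_and, mem_singleton]
    constructor
    · rintro ⟨a, b, c, d⟩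
      by_contra hne
      refine hc u (lt_of_le_of_ne a (Ne.symm hne)) b (lt_of_le_of_ne c ?_) d
      exact fun e => hne (x.injective e).symm
    · rintro rfl
      exact ⟨le_rfl, hij, le_rfl, hx⟩
  have h2 : ∑ u ∈ (univ.erase i).erase j,
        (if ((i : ℕ) < (u : ℕ) ∧ (u : ℕ) ≤ j ∧ (x i : ℕ) < x u ∧ (x u : ℕ) ≤ x j) then 1 else 0)
        = 0 := by
    refine sum_eq_zero fun u hu => if_neg ?_
    simp only [mem_erase, mem_univ, and_true] at hu
    rintro ⟨a, b, c, d⟩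
    refine hc u a (lt_of_le_of_ne (Fin.le_def.2 b) hu.1) c (lt_of_le_of_ne (Fin.le_def.2 d) ?_)
    exact fun e => hu.1 (x.injective e)
  omega

theorem length_le (x : Perm (Fin n)) : length x ≤ ∑ p : Fin n, (p : ℕ) := by
  rw [← length_add_sum x]
  exact Nat.le_add_right _ _

end Ranks

/-! ### The rank criterion for the Bruhat order, by covers in the first differing row. -/

section Bruhat

variable {n : ℕ}

/-- The rank-function description of the Bruhat order. -/
def RankLE (x w : Perm (Fin n)) : Prop :=
  ∀ a c : ℕ, rkN w a c ≤ rkN x a c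

theorem exists_first {P : Fin n → Prop} (h : ∃ u, P u) : ∃ k, P k ∧ ∀ u < k, ¬ P u := by
  obtain ⟨k, hk, hmin⟩ := wellFounded_lt.has_min {u | P u} h
  exact ⟨k, hk, fun u hu hp => hmin u hp hu⟩

theorem apply_le_of_rkN_le {x w : Perm (Fin n)} {r : Fin n} (hr : ∀ u < r, x u = w u)
    (h : rkN w (r + 1) (w r + 1) ≤ rkN x (r + 1) (w r + 1)) : x r ≤ w r := by
  by_contra! hlt
  have h2 : rkN x (r + 1) (w r + 1) + 1 ≤ rkN w (r + 1) (w r + 1) := by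
    refine card_filter_lt_of_imp (fun u hu => ?_) r (by omega) ?_
    · refine ⟨hu.1, ?_⟩
      rcases lt_or_eq_of_le (Nat.lt_succ_iff.1 hu.1) with h | h
      · rw [← hr u h]
        exact hu.2
      · have : u = r := Fin.ext h
        subst this
        omega
    · rintro ⟨-, h⟩
      rw [Fin.lt_def] at hlt
      omega
  omega

theorem RankLE.apply_le {x w : Perm (Fin n)} (h : RankLE x w) {r : Fin n}
    (hr : ∀ u < r, x u = w u) : x r ≤ w r :=
  apply_le_of_rkN_le hr (h _ _)

theorem le_of_apply_eq_of_agree {x w : Perm (Fin n)} {r : Fin n} (hr : ∀ u < r, x u = w u)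
    {u v : Fin n} (hv : r ≤ v) (h : x u = w v) : r ≤ u := by
  by_contra! hlt
  rw [hr u hlt] at h
  have := w.injective h
  subst this
  exact absurd hlt (not_lt.2 hv)

/-- `r` is at most the first row in which `x` and `w` differ, `k` is a lower row such that
exchanging the two is a cover of `x`, and the ranks of `x` and `w` differ on the rectangle
affected by the exchange. -/
structure RowCover (w x : Perm (Fin n)) (r k : Fin n) : Prop where
  agree : ∀ u < r, x u = w u
  lt : r < k
  val_lt : x r < x k
  empty : ∀ u, r < u → u < k → x r < x u → x u < x k → False
  gap : ∀ a c : ℕ, r < a → a ≤ k → x r < c → c ≤ x k → rkN w a c < rkN x a c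

theorem RowCover.length_eq {w x : Perm (Fin n)} {r k : Fin n} (h : RowCover w x r k) :
    length (x * swap r k) = length x + 1 :=
  length_mul_swap_of_cover x h.lt h.val_lt h.empty

theorem RankLE.mul_swap {w x : Perm (Fin n)} (hle : RankLE x w) {i j : Fin n} (hij : i < j)
    (hx : x i < x j)
    (hgap : ∀ a c : ℕ, i < a → a ≤ j → x i < c → c ≤ x j → rkN w a c < rkN x a c) :
    RankLE (x * swap i j) w := by
  intro a c
  by_cases h : (i : ℕ) < a ∧ a ≤ j ∧ (x i : ℕ) < c ∧ c ≤ x j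
  · have h1 := hgap a c h.1 h.2.1 h.2.2.1 h.2.2.2
    have h2 := rkN_mul_swap_of_mem x hij hx h.1 h.2.1 h.2.2.1 h.2.2.2
    omega
  · rw [rkN_mul_swap_of_notMem x hij hx h]
    exact hle a c

theorem RowCover.rankLE {w x : Perm (Fin n)} {r k : Fin n} (h : RowCover w x r k)
    (hle : RankLE x w) : RankLE (x * swap r k) w :=
  hle.mul_swap h.lt h.val_lt h.gap

theorem mul_swap_apply_of_lt (x : Perm (Fin n)) {r k u : Fin n} (hk : r < k) (hu : u < r) :
    (x * swap r k) u = x u := by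
  rw [Perm.mul_apply, swap_apply_of_ne_of_ne hu.ne (hu.trans hk).ne]

theorem mul_swap_apply_left (x : Perm (Fin n)) (i j : Fin n) : (x * swap i j) i = x j := by
  rw [Perm.mul_apply, swap_apply_left]

theorem mul_swap_apply_right (x : Perm (Fin n)) (i j : Fin n) : (x * swap i j) j = x i := by
  rw [Perm.mul_apply, swap_apply_right]

theorem mul_swap_apply_of_ne (x : Perm (Fin n)) {i j u : Fin n} (hi : u ≠ i) (hj : u ≠ j) :
    (x * swap i j) u = x u := by
  rw [Perm.mul_apply, swap_apply_of_ne_of_ne hi hj]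

/-- The first row in which `x` and `w` differ supports a cover of `x`; the ranks differ even on
the larger rectangle reaching up to the value of `w`. -/
theorem exists_rowCover {w x : Perm (Fin n)} (hle : RankLE x w) {r : Fin n}
    (hr : ∀ u < r, x u = w u) (hlt : x r < w r) :
    ∃ k, RowCover w x r k ∧ x k ≤ w r ∧
      (∀ u, r < u → u < k → x r < x u → x u ≤ w r → False) ∧
      ∀ a c : ℕ, r < a → a ≤ k → x r < c → c ≤ w r → rkN w a c < rkN x a c := by
  -- The row where `x` takes the value `w r` shows that such a `k` exists; taking the first one
  -- keeps the rectangle empty.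
  obtain ⟨k, ⟨hk1, hk2, hk3⟩, hmin⟩ :=
    exists_first (P := fun k => r < k ∧ x r < x k ∧ x k ≤ w r) ⟨x.symm (w r), by
      have h1 : r ≤ x.symm (w r) := le_of_apply_eq_of_agree hr le_rfl (by simp)
      refine ⟨lt_of_le_of_ne h1 ?_, by simpa using hlt, by simp⟩
      intro e
      rw [eq_symm_apply] at e
      exact hlt.ne e⟩
  have hmin' : ∀ u, r < u → u < k → x r < x u → x u ≤ w r → False :=
    fun u h1 h2 h3 h4 => hmin u h2 ⟨h1, h3, h4⟩
  have hgap : ∀ a c : ℕ, r < a → a ≤ k → x r < c → c ≤ w r → rkN w a c < rkN x a c := by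
    intro a c h1 h2 h3 h4
    have e1 := rkN_add_band x a (show c ≤ (w r : ℕ) + 1 by omega)
    have e2 := rkN_add_band w a (show c ≤ (w r : ℕ) + 1 by omega)
    -- Down to row `k`, the points of `x` in these columns lie above row `r`, where `w` has them
    -- too; `w` has row `r` in addition.
    have e3 : band x a c (w r + 1) + 1 ≤ band w a c (w r + 1) := by
      refine card_filter_lt_of_imp (fun u hu => ?_) r ⟨h1, h4, by omega⟩ ?_
      · rcases lt_trichotomy u r with h | rfl | h
        · rw [← hr u h]
          exact hu
        · omega
        · exact (hmin' u h (by rw [Fin.lt_def]; omega) (by rw [Fin.lt_def]; omega)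
            (by rw [Fin.le_def]; omega)).elim
      · omega
    have := hle a (w r + 1)
    omega
  refine ⟨k, ⟨hr, hk1, hk2, fun u h1 h2 h3 h4 => hmin' u h1 h2 h3 (h4.le.trans hk3), ?_⟩, hk3,
    hmin', hgap⟩
  intro a c h1 h2 h3 h4
  exact hgap a c h1 h2 h3 (h4.trans hk3)

theorem exists_first_ne {x w : Perm (Fin n)} (hne : x ≠ w) :
    ∃ r, x r ≠ w r ∧ ∀ u < r, x u = w u := by
  obtain ⟨r, h1, h2⟩ := exists_first (P := fun r => x r ≠ w r)
    (by by_contra! h; exact hne (Equiv.ext h))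
  exact ⟨r, h1, fun u hu => by simpa using h2 u hu⟩

theorem bruhatStep_mul_swap (x : Perm (Fin n)) {i j : Fin n} (hij : i < j) (hx : x i < x j) :
    BruhatStep x (x * swap i j) :=
  ⟨⟨swap i j, ⟨i, j, hij.ne, rfl⟩, rfl⟩, length_lt_mul_swap x hij hx⟩

/-- Covers in the first differing row climb from `x` while staying below `w` in rank; since lengths
are bounded, the climb can only end at `w`. -/
theorem RankLE.bruhatLE {x w : Perm (Fin n)} (hle : RankLE x w) : BruhatLE x w := by
  induction h : (∑ p : Fin n, (p : ℕ)) - length x using Nat.strong_induction_on generalizing x with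
  | _ m ih =>
    by_cases hne : x = w
    · subst hne
      exact Relation.ReflTransGen.refl
    · obtain ⟨r, h1, h2⟩ := exists_first_ne hne
      obtain ⟨k, hc, -⟩ := exists_rowCover hle h2 (lt_of_le_of_ne (hle.apply_le h2) h1)
      have := hc.length_eq
      have := length_le (x * swap r k)
      exact Relation.ReflTransGen.head (bruhatStep_mul_swap x hc.lt hc.val_lt)
        (ih _ (by omega) (hc.rankLE hle) rfl)

theorem exists_swap_lt {t : Perm (Fin n)} (ht : t.IsSwap) : ∃ i j, i < j ∧ t = swap i j := by
  obtain ⟨i, j, hne, rfl⟩ := ht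
  rcases lt_or_gt_of_ne hne with h | h
  · exact ⟨i, j, h, rfl⟩
  · exact ⟨j, i, h, swap_comm i j⟩

theorem apply_lt_of_length_lt {x : Perm (Fin n)} {i j : Fin n} (hij : i < j)
    (h : length x < length (x * swap i j)) : x i < x j := by
  by_contra! hle
  have hlt : x j < x i := lt_of_le_of_ne hle (fun e => hij.ne' (x.injective e))
  have := length_lt_mul_swap (x * swap i j) hij
    (by rwa [mul_swap_apply_left, mul_swap_apply_right])
  rw [mul_swap_mul_self] at this
  omega

theorem BruhatLE.rankLE {x w : Perm (Fin n)} (h : BruhatLE x w) : RankLE x w := by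
  induction h with
  | refl => exact fun a c => le_rfl
  | tail _ hs ih =>
    obtain ⟨⟨t, ht, rfl⟩, hl⟩ := hs
    obtain ⟨i, j, hij, rfl⟩ := exists_swap_lt ht
    exact fun a c => (rkN_mul_swap_le _ hij (apply_lt_of_length_lt hij hl) a c).trans (ih a c)

theorem BruhatLE.length_le {x w : Perm (Fin n)} (h : BruhatLE x w) : length x ≤ length w := by
  induction h with
  | refl => exact le_rfl
  | tail _ hs ih => exact ih.trans hs.2.le

/-! ### Reflections of a pair and Deodhar's inequality. -/

open Classical in
/-- The pairs `i < j` of non-inverted rows of `x` whose exchange stays below `w`. -/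
noncomputable def reflPairs (w x : Perm (Fin n)) : Finset (Fin n × Fin n) :=
  {p | p.1 < p.2 ∧ x p.1 < x p.2 ∧
    ∀ a c : ℕ, p.1 < a → a ≤ p.2 → x p.1 < c → c ≤ x p.2 → rkN w a c < rkN x a c}

theorem mem_reflPairs {w x : Perm (Fin n)} {i j : Fin n} :
    (i, j) ∈ reflPairs w x ↔ i < j ∧ x i < x j ∧
      ∀ a c : ℕ, i < a → a ≤ j → x i < c → c ≤ x j → rkN w a c < rkN x a c := by
  simp [reflPairs]

theorem swap_injOn_lt {i j k l : Fin n} (hij : i < j) (hkl : k < l) (h : swap i j = swap k l) :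
    i = k ∧ j = l := by
  have h1 : swap k l i = j := by rw [← h, swap_apply_left]
  have h2 : swap k l j = i := by rw [← h, swap_apply_right]
  rw [swap_apply_def] at h1 h2
  split_ifs at h1 h2 <;> subst_vars <;> (simp_all; try omega)

/-- The exchange stays below `w` exactly when every rank in its rectangle can afford to drop by one.
-/
theorem ncard_reflectionSet {w x : Perm (Fin n)} (hle : RankLE x w) :
    (reflectionSet w x).ncard = #(reflPairs w x) := by
  have : reflectionSet w x = (fun p : Fin n × Fin n => swap p.1 p.2) '' (reflPairs w x) := by
    ext t
    constructor
    · rintro ⟨ht, hlt, htw⟩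
      obtain ⟨i, j, hij, rfl⟩ := exists_swap_lt ht
      refine ⟨(i, j), ?_, rfl⟩
      have hx : x i < x j := by
        by_contra! hge
        have hgt : x j < x i := lt_of_le_of_ne hge (fun e => hij.ne' (x.injective e))
        have h1 := length_lt_mul_swap (x * swap i j) hij
          (by rwa [mul_swap_apply_left, mul_swap_apply_right])
        rw [mul_swap_mul_self] at h1
        have := hlt.1.length_le
        omega
      rw [mem_coe, mem_reflPairs]
      refine ⟨hij, hx, fun a c h1 h2 h3 h4 => ?_⟩
      have := rkN_mul_swap_of_mem x hij hx h1 h2 h3 h4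
      have := htw.rankLE a c
      omega
    · rintro ⟨⟨i, j⟩, hp, rfl⟩
      rw [mem_coe, mem_reflPairs] at hp
      obtain ⟨hij, hx, hgap⟩ := hp
      refine ⟨⟨i, j, hij.ne, rfl⟩, ⟨Relation.ReflTransGen.single (bruhatStep_mul_swap x hij hx), ?_⟩,
        (hle.mul_swap hij hx hgap).bruhatLE⟩
      intro e
      have := length_lt_mul_swap x hij hx
      dsimp only at e
      rw [← e] at this
      exact lt_irrefl _ this
  rw [this, Set.InjOn.ncard_image, Set.ncard_coe_finset]
  rintro ⟨i, j⟩ hp ⟨k, l⟩ hq h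
  rw [mem_coe, mem_reflPairs] at hp hq
  obtain ⟨rfl, rfl⟩ := swap_injOn_lt hp.1 hq.1 h
  rfl

/-- Passing to a cover in the first differing row loses at least one reflection. -/
theorem RowCover.card_reflPairs_lt {w x : Perm (Fin n)} {r k : Fin n} (h : RowCover w x r k) :
    #(reflPairs w (x * swap r k)) + 1 ≤ #(reflPairs w x) := by
  classical
  set x' := x * swap r k with hx'
  have hr' : x' r = x k := mul_swap_apply_left x r k
  have hk' : x' k = x r := mul_swap_apply_right x r k
  have hne : ∀ {u}, u ≠ r → u ≠ k → x' u = x u := fun h1 h2 => mul_swap_apply_of_ne x h1 h2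
  have hle : ∀ a c, rkN x' a c ≤ rkN x a c := rkN_mul_swap_le x h.lt h.val_lt
  have hrk := h.lt
  have hval := h.val_lt
  -- Above row `r` the ranks of `x'` and `w` agree, so no rectangle with a strict gap starts there.
  have hge : ∀ {i j}, (i, j) ∈ reflPairs w x' → r ≤ i := by
    intro i j hp
    rw [mem_reflPairs] at hp
    by_contra! hlt
    have h1 := hp.2.2 (i + 1) (x' i + 1) (by omega) (by have := hp.1; omega) (by omega)
      (by have := hp.2.1; omega)
    have h2 : rkN x' (i + 1) (x' i + 1) = rkN w (i + 1) (x' i + 1) :=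
      rkN_congr (r := r) (fun u hu => (mul_swap_apply_of_lt x hrk hu).trans (h.agree u hu))
        (by omega) _
    omega
  have hrj : ∀ {j}, (r, j) ∈ reflPairs w x' → r < j ∧ j ≠ k ∧ x' j = x j ∧ x k < x j := by
    intro j hp
    rw [mem_reflPairs] at hp
    have hjk : j ≠ k := by
      rintro rfl
      rw [hr', hk'] at hp
      exact lt_asymm hp.2.1 hval
    have := hne hp.1.ne' hjk
    rw [hr', this] at hp
    exact ⟨hp.1, hjk, this, hp.2.1⟩
  have hmem : (r, k) ∈ reflPairs w x := mem_reflPairs.2 ⟨hrk, hval, h.gap⟩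
  -- An injection missing `(r, k)`. A pair `(k, j)` that is inverted in `x` moves to `(r, j)`; a
  -- pair `(r, j)` with `k < j` moves to `(k, j)` if that place is free, and otherwise the gap over
  -- `(k, j)` supplies the part of its enlarged rectangle that is missing. Collisions at `(r, j)`
  -- are excluded by comparing `x j` with `x k`.
  let φ : Fin n × Fin n → Fin n × Fin n := fun p =>
    if p.1 = k ∧ x p.2 < x k then (r, p.2)
    else if p.1 = r ∧ k < p.2 ∧ (k, p.2) ∉ reflPairs w x' then (k, p.2) else p
  rw [← card_erase_add_one hmem]
  refine Nat.succ_le_succ (card_le_card_of_injOn φ ?_ ?_)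
  · rintro ⟨i, j⟩ hp
    have hri := hge hp
    have hp' := mem_reflPairs.1 hp
    obtain ⟨hij, hxij, hgap⟩ := hp'
    rw [mem_coe, mem_erase]
    by_cases hir : i = r
    · subst hir
      obtain ⟨-, hjk, hxj, hkj⟩ := hrj hp
      rw [hr', hxj] at hgap
      by_cases hc : k < j ∧ (k, j) ∉ reflPairs w x'
      · have : φ (i, j) = (k, j) := by simp [φ, hrk.ne, hc]
        rw [this]
        refine ⟨by simp [hrk.ne'], mem_reflPairs.2 ⟨hc.1, hkj, fun a c h1 h2 h3 h4 => ?_⟩⟩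
        exact (hgap a c (by omega) h2 h3 h4).trans_le (hle a c)
      · have : φ (i, j) = (i, j) := by
          simp only [φ]
          rw [if_neg (by simp [hrk.ne]), if_neg (fun hh => hc hh.2)]
        rw [this]
        refine ⟨by simp [hjk], mem_reflPairs.2 ⟨hij, hval.trans hkj, fun a c h1 h2 h3 h4 => ?_⟩⟩
        by_cases hcc : c ≤ x k
        · by_cases ha : a ≤ k
          · exact h.gap a c h1 ha h3 hcc
          · have hk2 : (k, j) ∈ reflPairs w x' := by
              by_contra hh
              exact hc ⟨by rw [Fin.lt_def]; omega, hh⟩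
            rw [mem_reflPairs, hk', hxj] at hk2
            exact (hk2.2.2 a c (by omega) h2 h3 h4).trans_le (hle a c)
        · exact (hgap a c h1 h2 (by omega) h4).trans_le (hle a c)
    · by_cases hik : i = k
      · subst hik
        have hxj : x' j = x j := hne (hrk.trans hij).ne' hij.ne'
        rw [hk', hxj] at hgap hxij
        by_cases hc : x j < x i
        · have : φ (i, j) = (r, j) := by simp [φ, hc]
          rw [this]
          refine ⟨by simp [hij.ne'], mem_reflPairs.2 ⟨hrk.trans hij, hxij,
            fun a c h1 h2 h3 h4 => ?_⟩⟩
          by_cases ha : a ≤ i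
          · exact h.gap a c h1 ha h3 (by omega)
          · exact (hgap a c (by omega) h2 h3 h4).trans_le (hle a c)
        · have : φ (i, j) = (i, j) := by simp [φ, hc, hir]
          rw [this]
          have hlt : x i < x j := lt_of_le_of_ne (not_lt.1 hc) (fun e => hij.ne (x.injective e))
          refine ⟨by simp [hir], mem_reflPairs.2 ⟨hij, hlt, fun a c h1 h2 h3 h4 => ?_⟩⟩
          exact (hgap a c h1 h2 (by omega) h4).trans_le (hle a c)
      · have : φ (i, j) = (i, j) := by simp [φ, hik, hir]
        rw [this, hne hir hik] at *
        have hri' : r < i := lt_of_le_of_ne hri (Ne.symm hir)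
        by_cases hjk : j = k
        · subst hjk
          rw [hk'] at hgap hxij
          refine ⟨by simp [hir], mem_reflPairs.2 ⟨hij, hxij.trans hval, fun a c h1 h2 h3 h4 => ?_⟩⟩
          by_cases hc : c ≤ x r
          · exact (hgap a c h1 h2 h3 hc).trans_le (hle a c)
          · exact h.gap a c (by omega) h2 (by omega) h4
        · rw [hne (hri'.trans hij).ne' hjk] at hgap hxij
          refine ⟨by simp [hir], mem_reflPairs.2 ⟨hij, hxij, fun a c h1 h2 h3 h4 => ?_⟩⟩
          exact (hgap a c h1 h2 h3 h4).trans_le (hle a c)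
  · rintro ⟨i, j⟩ hp ⟨i', j'⟩ hq he
    rw [mem_coe] at hp hq
    have hj : j = j' := by
      have := congrArg Prod.snd he
      simp only [φ] at this
      split_ifs at this <;> exact this
    subst hj
    have hnot : ∀ {j}, (r, j) ∈ reflPairs w x' → ¬ x j < x k :=
      fun hh => not_lt.2 (hrj hh).2.2.2.le
    have he' := congrArg Prod.fst he
    simp only [φ] at he'
    have hrk' := hrk.ne
    split_ifs at he' with c1 c2 c3 c4 c5 c6 c7 c8 <;> dsimp only at he' <;> grind

/-- Each cover on the way to `w` gains one in length and loses at least one reflection. -/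
theorem card_reflPairs_lower_bound {w x : Perm (Fin n)} (hle : RankLE x w) :
    length w ≤ length x + #(reflPairs w x) := by
  induction h : (∑ p : Fin n, (p : ℕ)) - length x using Nat.strong_induction_on generalizing x with
  | _ m ih =>
    by_cases hne : x = w
    · subst hne
      exact Nat.le_add_right _ _
    · obtain ⟨r, h1, h2⟩ := exists_first_ne hne
      obtain ⟨k, hc, -⟩ := exists_rowCover hle h2 (lt_of_le_of_ne (hle.apply_le h2) h1)
      have h3 := hc.length_eq
      have := length_le (x * swap r k)
      have h4 := ih _ (by omega) (hc.rankLE hle) rfl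
      have := hc.card_reflPairs_lt
      omega

/-- Smoothness in terms of ranks. -/
structure RankSmooth (w x : Perm (Fin n)) : Prop where
  rankLE : RankLE x w
  card_le : length x + #(reflPairs w x) ≤ length w

/-- The length grows by exactly one while at least one reflection is lost, so the inequality
persists. -/
theorem RankSmooth.of_rowCover {w x : Perm (Fin n)} {r k : Fin n} (hs : RankSmooth w x)
    (h : RowCover w x r k) : RankSmooth w (x * swap r k) := by
  refine ⟨h.rankLE hs.rankLE, ?_⟩
  have := h.length_eq
  have := h.card_reflPairs_lt
  have := hs.card_le
  omega

end Bruhat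

/-! ### Reflections in the first differing row against records of `w`. -/

section RowCount

variable {n : ℕ}

/-- The rows `s > r` at which the values of `w` in `[v, w r)` reach a new minimum. -/
def records (w : Perm (Fin n)) (r v : Fin n) : Finset (Fin n) :=
  {s | r < s ∧ v ≤ w s ∧ w s < w r ∧ ∀ u, r < u → u < s → v ≤ w u → ¬ w u < w s}

/-- Lowering the first differing row of `w` to the value of `x`. -/
theorem exists_lowering {w x : Perm (Fin n)} (hle : RankLE x w) {r : Fin n}
    (hr : ∀ u < r, x u = w u) :
    ∃ v, RankLE x v ∧ RankLE v w ∧ (∀ u < r, x u = v u) ∧ v r = x r ∧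
      length w ≤ length v + #(records w r (x r)) := by
  induction h : (w r : ℕ) using Nat.strong_induction_on generalizing w with
  | _ m ih =>
    have hxw := hle.apply_le hr
    rcases eq_or_lt_of_le hxw with heq | hlt
    · exact ⟨w, hle, fun a c => le_rfl, hr, heq.symm, Nat.le_add_right _ _⟩
    · obtain ⟨k, ⟨hk1, hk2, hk3⟩, hmin⟩ :=
        exists_first (P := fun k => r < k ∧ x r ≤ w k ∧ w k < w r) ⟨w.symm (x r), by
          have h1 : r ≤ w.symm (x r) :=
            le_of_apply_eq_of_agree (fun u hu => (hr u hu).symm) le_rfl (by simp)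
          refine ⟨lt_of_le_of_ne h1 ?_, by simp, by simpa using hlt⟩
          intro e
          rw [eq_symm_apply] at e
          exact hlt.ne' e⟩
      set w' := w * swap r k with hw'
      have e0 : w' * swap r k = w := mul_swap_mul_self _ _ _
      have er : w' r = w k := mul_swap_apply_left w r k
      have ek : w' k = w r := mul_swap_apply_right w r k
      have hval : w' r < w' k := by rwa [er, ek]
      have hne : ∀ {u}, u ≠ r → u ≠ k → w' u = w u := fun h1 h2 => mul_swap_apply_of_ne w h1 h2
      have hww : RankLE w' w := by
        have := rkN_mul_swap_le w' hk1 hval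
        rwa [e0] at this
      have hr' : ∀ u < r, x u = w' u := fun u hu =>
        (hr u hu).trans (mul_swap_apply_of_lt w hk1 hu).symm
      have hxw' : RankLE x w' := by
        intro a c
        have h1 := rkN_mul_swap w' hk1 hval a c
        rw [e0, er, ek] at h1
        split_ifs at h1 with hq
        · have e1 := rkN_add_band x a (show (x r : ℕ) ≤ c by rw [Fin.le_def] at hk2; omega)
          have e2 := rkN_add_band w a (show (x r : ℕ) ≤ c by rw [Fin.le_def] at hk2; omega)
          have e3 : band w a (x r) c + 1 ≤ band x a (x r) c := by
            refine card_filter_lt_of_imp (fun u hu => ?_) r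
              ⟨hq.1, le_rfl, by rw [Fin.le_def] at hk2; omega⟩ (by omega)
            rcases lt_trichotomy u r with h | rfl | h
            · rw [hr u h]
              exact hu
            · omega
            · exact (hmin u (by rw [Fin.lt_def]; omega)
                ⟨h, by rw [Fin.le_def]; omega, by rw [Fin.lt_def]; omega⟩).elim
          have := hle a (x r)
          omega
        · have := hle a c
          omega
      have hlen : length w = length w' + 1 := by
        rw [← length_mul_swap_of_cover w' hk1 hval, e0]
        intro u h1 h2 h3 h4
        rw [er, hne h1.ne' h2.ne] at h3
        rw [ek, hne h1.ne' h2.ne] at h4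
        exact hmin u h2 ⟨h1, hk2.trans h3.le, h4⟩
      obtain ⟨v, hv1, hv2, hv3, hv4, hv5⟩ :=
        ih (w' r) (by rw [er, ← h]; exact hk3) hxw' hr' rfl
      refine ⟨v, hv1, fun a c => (hww a c).trans (hv2 a c), hv3, hv4, ?_⟩
      -- Row `k` is the first record of `w`. In `w'` it holds the old value `w r` and is no record,
      -- while every record of `w'` is one of `w`.
      have hrec : #(records w' r (x r)) + 1 ≤ #(records w r (x r)) := by
        refine card_filter_lt_of_imp (fun s hs => ?_) k ⟨hk1, hk2, hk3, fun u h1 h2 h3 h4 =>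
          hmin u h2 ⟨h1, h3, h4.trans hk3⟩⟩ ?_
        · obtain ⟨h1, h2, h3, h4⟩ := hs
          have hsk : s ≠ k := by
            rintro rfl
            rw [er, ek] at h3
            exact lt_asymm h3 hk3
          rw [hne h1.ne' hsk, er] at h3
          rw [hne h1.ne' hsk] at h2 h4
          refine ⟨h1, h2, h3.trans hk3, fun u g1 g2 g3 g4 => ?_⟩
          by_cases huk : u = k
          · subst huk
            exact lt_asymm g4 h3
          · have := h4 u g1 g2
            rw [hne g1.ne' huk] at this
            exact this g3 g4
        · rintro ⟨-, -, h3, -⟩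
          rw [er, ek] at h3
          exact lt_asymm h3 hk3
      omega

-- Take `v` between `x` and `w` with `v r = x r`. No reflection of `(v, x)` starts in row `r`, so
-- those of `(v, x)` and those of `(w, x)` in row `r` are disjoint among the reflections of `(w,
-- x)`. Deodhar's inequality for `(v, x)` and smoothness leave for row `r` at most `ℓ(w) - ℓ(v)`,
-- hence at most the number of records.
open Classical in
theorem RankSmooth.card_row_le {w x : Perm (Fin n)} (hs : RankSmooth w x) {r : Fin n}
    (hr : ∀ u < r, x u = w u) :
    #{s | (r, s) ∈ reflPairs w x} ≤ #(records w r (x r)) := by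
  obtain ⟨v, h1, h2, h3, h4, h5⟩ := exists_lowering hs.rankLE hr
  have h6 := card_reflPairs_lower_bound h1
  have h7 := hs.card_le
  have h8 : #(reflPairs v x) + #{s | (r, s) ∈ reflPairs w x} ≤ #(reflPairs w x) := by
    rw [← card_image_of_injective ({s | (r, s) ∈ reflPairs w x} : Finset (Fin n))
      (Prod.mk_right_injective r), ← card_union_of_disjoint]
    · refine card_le_card (union_subset ?_ ?_)
      · rintro ⟨i, j⟩ hp
        rw [mem_reflPairs] at hp ⊢
        exact ⟨hp.1, hp.2.1, fun a c g1 g2 g3 g4 => (h2 a c).trans_lt (hp.2.2 a c g1 g2 g3 g4)⟩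
      · intro p hp
        obtain ⟨s, hs, rfl⟩ := mem_image.1 hp
        simpa using hs
    · rw [disjoint_left]
      rintro ⟨i, j⟩ hp hq
      obtain ⟨s, -, he⟩ := mem_image.1 hq
      obtain rfl : r = i := congrArg Prod.fst he
      rw [mem_reflPairs] at hp
      have g := hp.2.2 (r + 1) (x r + 1) (by omega) (by have := hp.1; omega) (by omega)
        (by have := hp.2.1; omega)
      have g' : rkN x (r + 1) (x r + 1) = rkN v (r + 1) (x r + 1) := by
        refine rkN_congr (r := r + 1) (fun u hu => ?_) le_rfl _
        rcases eq_or_lt_of_le (Nat.lt_succ_iff.1 hu) with h | h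
        · obtain rfl : u = r := Fin.ext h
          exact h4.symm
        · exact h3 u h
      omega
  omega

/-! ### The staircase of the level set and the equality case. -/

/-- The first row after `r` meeting, in the columns `(x r, c]`, a point of equal ranks. -/
noncomputable def cut (w x : Perm (Fin n)) (r : Fin n) (c : ℕ) : ℕ :=
  sInf {a | (r : ℕ) < a ∧ ∃ d : ℕ, (x r : ℕ) < d ∧ d ≤ c ∧ rkN x a d = rkN w a d}

theorem cut_mem (w x : Perm (Fin n)) (r : Fin n) {c : ℕ} (hc : (x r : ℕ) < c) :
    (r : ℕ) < cut w x r c ∧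
      ∃ d : ℕ, (x r : ℕ) < d ∧ d ≤ c ∧ rkN x (cut w x r c) d = rkN w (cut w x r c) d :=
  Nat.sInf_mem (s := {a | (r : ℕ) < a ∧
    ∃ d : ℕ, (x r : ℕ) < d ∧ d ≤ c ∧ rkN x a d = rkN w a d})
    -- Row `n`, where all ranks coincide, makes the set nonempty, so the infimum is attained.
    ⟨n, r.isLt, c, hc, le_rfl, by rw [rkN_of_row_ge x le_rfl, rkN_of_row_ge w le_rfl]⟩

theorem cut_le {w x : Perm (Fin n)} {r : Fin n} {a c d : ℕ} (ha : (r : ℕ) < a)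
    (hd : (x r : ℕ) < d) (hdc : d ≤ c) (h : rkN x a d = rkN w a d) : cut w x r c ≤ a :=
  Nat.sInf_le ⟨ha, d, hd, hdc, h⟩

theorem cut_anti {w x : Perm (Fin n)} {r : Fin n} {c d : ℕ} (hc : (x r : ℕ) < c) (hcd : c ≤ d) :
    cut w x r d ≤ cut w x r c := by
  obtain ⟨h1, e, h2, h3, h4⟩ := cut_mem w x r hc
  exact cut_le h1 h2 (h3.trans hcd) h4

/-- If the staircase steps at the new column, the point of equal ranks that causes it lies in that
column. -/
theorem cut_succ {w x : Perm (Fin n)} {r : Fin n} {c : ℕ} (hc : (x r : ℕ) < c) :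
    cut w x r (c + 1) = cut w x r c ∨
      rkN x (cut w x r (c + 1)) (c + 1) = rkN w (cut w x r (c + 1)) (c + 1) := by
  obtain ⟨h1, e, h2, h3, h4⟩ := cut_mem w x r (show (x r : ℕ) < c + 1 by omega)
  rcases Nat.lt_or_ge c e with h | h
  · obtain rfl : e = c + 1 := by omega
    exact Or.inr h4
  · exact Or.inl (le_antisymm (cut_anti hc (by omega)) (cut_le h1 h2 h h4))

theorem rkN_row_succ_eq {w x : Perm (Fin n)} {r : Fin n} (hr : ∀ u < r, x u = w u) {c : ℕ}
    (hc : (x r : ℕ) < c ↔ (w r : ℕ) < c) : rkN x (r + 1) c = rkN w (r + 1) c := by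
  unfold rkN
  congr 1
  ext u
  simp only [mem_filter, mem_univ, true_and, and_congr_right_iff]
  intro hu
  rcases eq_or_lt_of_le (Nat.lt_succ_iff.1 hu) with h | h
  · obtain rfl : u = r := Fin.ext h
    exact hc
  · rw [hr u h]

theorem cut_top {w x : Perm (Fin n)} {r : Fin n} (hr : ∀ u < r, x u = w u) (hlt : x r < w r) :
    cut w x r (w r + 1) = r + 1 := by
  have h1 : (x r : ℕ) < w r + 1 := by rw [Fin.lt_def] at hlt; omega
  refine le_antisymm (cut_le (by omega) h1 le_rfl (rkN_row_succ_eq hr (by omega))) ?_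
  have := (cut_mem w x r h1).1
  omega

/-- The number of points of `z` in the columns `[c, w r]` above the staircase `cut w x r`. -/
noncomputable def stair (w x : Perm (Fin n)) (r : Fin n) (z : Perm (Fin n)) (c : ℕ) : ℕ :=
  #{u : Fin n | c ≤ z u ∧ z u ≤ w r ∧ (u : ℕ) < cut w x r (z u)}

theorem stair_succ {w x : Perm (Fin n)} {r : Fin n} (z : Perm (Fin n)) {v : Fin n}
    (hv : v ≤ w r) : stair w x r z v =
      stair w x r z (v + 1) + if (z.symm v : ℕ) < cut w x r v then 1 else 0 := by
  unfold stair
  split_ifs with h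
  · rw [← card_insert_of_notMem (s := {u : Fin n | (v : ℕ) + 1 ≤ z u ∧ z u ≤ w r ∧
      (u : ℕ) < cut w x r (z u)}) (a := z.symm v) (by simp)]
    congr 1
    ext u
    simp only [mem_insert, mem_filter, mem_univ, true_and]
    by_cases hu : u = z.symm v
    · subst hu
      simp [hv, h]
    · have : (z u : ℕ) ≠ v := fun e => hu (by rw [eq_symm_apply]; exact Fin.ext e)
      simp only [hu, false_or, and_congr_left_iff]
      intro _
      omega
  · rw [add_zero]
    congr 1
    ext u
    simp only [mem_filter, mem_univ, true_and]
    by_cases hu : u = z.symm v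
    · subst hu
      simp [h]
    · have : (z u : ℕ) ≠ v := fun e => hu (by rw [eq_symm_apply]; exact Fin.ext e)
      simp only [and_congr_left_iff]
      intro _
      omega

/-- Summation by parts: the point of `z` in column `c` is counted once on each side, by `stair` on
the left and by the rank on the right. -/
theorem stair_add_rkN {w x : Perm (Fin n)} {r : Fin n} (z : Perm (Fin n)) {c : ℕ}
    (hc : c ≤ w r) : stair w x r z c + rkN z (cut w x r c) c =
      stair w x r z (c + 1) + rkN z (cut w x r c) (c + 1) := by
  have h1 := stair_succ (x := x) z (v := ⟨c, by omega⟩) (r := r) (w := w) hc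
  have h2 := rkN_succ_col z (cut w x r c) ⟨c, by omega⟩
  simp only at h1 h2
  omega

theorem stair_top (w x : Perm (Fin n)) (r : Fin n) (z : Perm (Fin n)) :
    stair w x r z (w r + 1) = 0 := by
  unfold stair
  rw [card_eq_zero, filter_eq_empty_iff]
  rintro u - ⟨h1, h2, -⟩
  rw [Fin.le_def] at h2
  omega

theorem eq_zero_of_antitone_on {f : ℕ → ℤ} {m M : ℕ}
    (hf : ∀ c, m ≤ c → c < M → f (c + 1) ≤ f c) (hm : f m ≤ 0) (hM : f M = 0) :
    ∀ c, m ≤ c → c ≤ M → f c = 0 := by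
  have h1 : ∀ c, m ≤ c → c ≤ M → f c ≤ 0 := by
    intro c hc
    induction c, hc using Nat.le_induction with
    | base => exact fun _ => hm
    | succ k hk ih => exact fun hkM => (hf k hk hkM).trans (ih (by omega))
  have h2 : ∀ d, ∀ c, m ≤ c → c + d = M → 0 ≤ f c := by
    intro d
    induction d with
    | zero => rintro c - rfl; exact hM.ge
    | succ d ih =>
      intro c hc hd
      exact le_trans (ih (c + 1) (by omega) (by omega)) (hf c hc (by omega))
  exact fun c hc hcM => le_antisymm (h1 c hc hcM) (h2 (M - c) c hc (by omega))

-- A point of `x` below row `r` but above the staircase sees no equality of ranks in its rectangle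
-- with row `r`, so it is a reflection.
open Classical in
theorem stair_left_le {w x : Perm (Fin n)} (hle : RankLE x w) {r : Fin n}
    (hr : ∀ u < r, x u = w u) :
    stair w x r x (x r + 1) ≤
      #{u : Fin n | u < r ∧ x r < w u ∧ w u ≤ w r} + #{s | (r, s) ∈ reflPairs w x} := by
  refine le_trans (card_filter_le_of_imp (Q := fun u => (u < r ∧ x r < w u ∧ w u ≤ w r) ∨
    (r, u) ∈ reflPairs w x) ?_) ((card_le_card (filter_or _ _ _).le).trans (card_union_le _ _))
  rintro u ⟨h1, h2, h3⟩
  have hxu : x r < x u := h1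
  rcases lt_trichotomy u r with h | rfl | h
  · left
    rw [← hr u h]
    exact ⟨h, hxu, h2⟩
  · exact absurd hxu (lt_irrefl _)
  · right
    rw [mem_reflPairs]
    refine ⟨h, hxu, fun a c g1 g2 g3 g4 => lt_of_le_of_ne (hle a c) fun e => ?_⟩
    have := cut_le g1 g3 g4 e.symm
    omega

/-- If the staircase passed at or above a record `s`, then between column `x r` and the point of
equality `w` would have no points in the rows after `r`, whereas `x` has row `r` itself. This would
make `rk_x < rk_w` in column `x r`. -/
theorem records_subset {w x : Perm (Fin n)} (hle : RankLE x w) {r : Fin n}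
    (hr : ∀ u < r, x u = w u) {s : Fin n} (hs : s ∈ records w r (x r)) :
    (s : ℕ) < cut w x r (w s) ∨ w s = x r := by
  simp only [records, mem_filter, mem_univ, true_and] at hs
  obtain ⟨h1, h2, h3, h4⟩ := hs
  rcases eq_or_lt_of_le h2 with h | h
  · exact Or.inr h.symm
  · left
    by_contra! hcut
    obtain ⟨g1, d, g2, g3, g4⟩ := cut_mem w x r (c := w s) h
    have e1 := rkN_add_band x (cut w x r (w s)) g2.le
    have e2 := rkN_add_band w (cut w x r (w s)) g2.le
    have e3 : band w (cut w x r (w s)) (x r) d + 1 ≤ band x (cut w x r (w s)) (x r) d := by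
      refine card_filter_lt_of_imp (fun u hu => ?_) r ⟨g1, le_rfl, g2⟩ ?_
      · rcases lt_trichotomy u r with h | rfl | h
        · rw [hr u h]
          exact hu
        · rw [Fin.lt_def] at h3
          omega
        · exact (h4 u h (by rw [Fin.lt_def]; omega) (by rw [Fin.le_def]; omega)
            (by rw [Fin.lt_def]; omega)).elim
      · rw [Fin.lt_def] at h3
        omega
    have := hle (cut w x r (w s)) (x r)
    omega

-- The record with value `x r` falls outside the columns counted; the point of `w` in row `r` makes
-- up for it.
open Classical in
theorem le_stair_left {w x : Perm (Fin n)} (hle : RankLE x w) {r : Fin n}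
    (hr : ∀ u < r, x u = w u) (hlt : x r < w r) :
    #{u : Fin n | u < r ∧ x r < w u ∧ w u ≤ w r} +
        #((({s | r < s ∧ x r < w s ∧ w s < w r ∧ (s : ℕ) < cut w x r (w s)} : Finset (Fin n)) \
          records w r (x r))) +
        #(records w r (x r)) ≤ stair w x r w (x r + 1) := by
  have hcut : ∀ {v : Fin n}, x r < v → (r : ℕ) < cut w x r v := fun hv => (cut_mem w x r hv).1
  have h1 := pred_card_le_card_erase (s := records w r (x r)) (a := w.symm (x r))
  set A : Finset (Fin n) := {u : Fin n | u < r ∧ x r < w u ∧ w u ≤ w r} with hA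
  set B : Finset (Fin n) := ({s | r < s ∧ x r < w s ∧ w s < w r ∧ (s : ℕ) < cut w x r (w s)} :
    Finset (Fin n)) \ records w r (x r) with hB
  set C := (records w r (x r)).erase (w.symm (x r)) with hC
  have hAr : ∀ u ∈ A, u < r := fun u hu => by simp only [hA, mem_filter] at hu; exact hu.2.1
  have hBr : ∀ u ∈ B, r < u := fun u hu => by
    simp only [hB, mem_sdiff, mem_filter] at hu; exact hu.1.2.1
  have hCr : ∀ u ∈ C, r < u := fun u hu => by
    simp only [hC, mem_erase, records, mem_filter] at hu; exact hu.2.2.1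
  have hBC : Disjoint B C := disjoint_left.2 fun u hu hu' =>
    (mem_sdiff.1 hu).2 (mem_of_mem_erase hu')
  have hABC : Disjoint A (B ∪ C) := disjoint_left.2 fun u hu hu' => by
    rcases mem_union.1 hu' with h | h
    · exact lt_asymm (hAr u hu) (hBr u h)
    · exact lt_asymm (hAr u hu) (hCr u h)
  have hr0 : r ∉ A ∪ (B ∪ C) := by
    intro h
    rcases mem_union.1 h with h | h
    · exact lt_irrefl _ (hAr r h)
    · rcases mem_union.1 h with h | h
      · exact lt_irrefl _ (hBr r h)
      · exact lt_irrefl _ (hCr r h)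
  have hsub : insert r (A ∪ (B ∪ C)) ⊆
      ({u : Fin n | (x r : ℕ) + 1 ≤ w u ∧ w u ≤ w r ∧ (u : ℕ) < cut w x r (w u)} :
        Finset (Fin n)) := by
    intro u hu
    simp only [mem_filter, mem_univ, true_and]
    rcases mem_insert.1 hu with rfl | hu
    · exact ⟨hlt, le_rfl, hcut hlt⟩
    rcases mem_union.1 hu with hu | hu
    · simp only [hA, mem_filter, mem_univ, true_and] at hu
      refine ⟨hu.2.1, hu.2.2, lt_trans (Fin.lt_def.1 hu.1) (hcut hu.2.1)⟩
    rcases mem_union.1 hu with hu | hu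
    · simp only [hB, mem_sdiff, mem_filter, mem_univ, true_and] at hu
      exact ⟨hu.1.2.1, hu.1.2.2.1.le, hu.1.2.2.2⟩
    · rw [hC, mem_erase] at hu
      have hne : w u ≠ x r := fun e => hu.1 (by rw [eq_symm_apply]; exact e)
      have h2 := (records_subset hle hr hu.2).resolve_right hne
      have h3 := hu.2
      simp only [records, mem_filter, mem_univ, true_and] at h3
      exact ⟨lt_of_le_of_ne h3.2.1 hne.symm, h3.2.2.1.le, h2⟩
  have h2 := card_le_card hsub
  rw [card_insert_of_notMem hr0, card_union_of_disjoint hABC, card_union_of_disjoint hBC] at h2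
  unfold stair
  omega

/-- Equality in the count of reflections in the first differing row of a smooth pair: the rank
difference is constant where the staircase steps, and the points of `w` above the staircase are
records. -/
theorem RankSmooth.staircase {w x : Perm (Fin n)} (hs : RankSmooth w x) {r : Fin n}
    (hr : ∀ u < r, x u = w u) (hlt : x r < w r) :
    (∀ c : ℕ, x r < c → c ≤ w r →
      rkN x (cut w x r c) (c + 1) + rkN w (cut w x r (c + 1)) (c + 1) =
        rkN w (cut w x r c) (c + 1) + rkN x (cut w x r (c + 1)) (c + 1)) ∧
    ∀ s, r < s → x r < w s → w s < w r → (s : ℕ) < cut w x r (w s) →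
      s ∈ records w r (x r) := by
  classical
  have hle := hs.rankLE
  -- By summation by parts `f` changes only where the staircase steps. There the rank difference
  -- vanishes at the new corner and is nonnegative at the old one, so `f` is antitone.
  set f : ℕ → ℤ := fun c => (stair w x r x c + rkN x (cut w x r c) c : ℤ) -
    (stair w x r w c + rkN w (cut w x r c) c) with hf
  have hstep : ∀ c : ℕ, x r < c → c ≤ w r → f c = f (c + 1) +
      ((rkN x (cut w x r c) (c + 1) + rkN w (cut w x r (c + 1)) (c + 1) : ℤ) -
        (rkN w (cut w x r c) (c + 1) + rkN x (cut w x r (c + 1)) (c + 1))) := by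
    intro c h1 h2
    have g1 := stair_add_rkN (x := x) (r := r) (w := w) x h2
    have g2 := stair_add_rkN (x := x) (r := r) (w := w) w h2
    simp only [hf]
    omega
  have hanti : ∀ c : ℕ, x r + 1 ≤ c → c < w r + 1 → f (c + 1) ≤ f c := by
    intro c h1 h2
    rw [hstep c (by omega) (by omega)]
    have := hle (cut w x r c) (c + 1)
    rcases cut_succ (w := w) (x := x) (r := r) (c := c) (by omega) with h | h
    · rw [h]
      omega
    · omega
  have hbot : f (x r + 1) = (stair w x r x (x r + 1) : ℤ) - stair w x r w (x r + 1) := by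
    obtain ⟨h1, d, h2, h3, h4⟩ := cut_mem w x r (show (x r : ℕ) < x r + 1 by omega)
    obtain rfl : d = x r + 1 := by omega
    simp only [hf, h4]
    omega
  have htop : f (w r + 1) = 0 := by
    simp only [hf, stair_top, cut_top hr hlt]
    rw [rkN_row_succ_eq hr (by rw [Fin.lt_def] at hlt; omega)]
    omega
  have hA := stair_left_le hle hr
  have hB := hs.card_row_le hr
  have hC := le_stair_left hle hr hlt
  -- The three counts give `f ≤ 0` at the left end, and `f = 0` at the right end; antitonicity
  -- forces `f = 0` throughout.
  have hzero := eq_zero_of_antitone_on hanti (by rw [hbot]; omega) htop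
  rw [Fin.lt_def] at hlt
  refine ⟨fun c h1 h2 => ?_, fun s h1 h2 h3 h4 => ?_⟩
  · have g1 := hstep c h1 h2
    rw [hzero c (by omega) (by omega), hzero (c + 1) (by omega) (by omega)] at g1
    omega
  · by_contra hnot
    have h0 := hzero (x r + 1) le_rfl (by omega)
    rw [hbot] at h0
    have : 0 < #((({s | r < s ∧ x r < w s ∧ w s < w r ∧ (s : ℕ) < cut w x r (w s)} :
        Finset (Fin n)) \ records w r (x r))) :=
      card_pos.2 ⟨s, by simp only [mem_sdiff, mem_filter, mem_univ, true_and]; exact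
        ⟨⟨h1, h2, h3, h4⟩, hnot⟩⟩
    omega

/-- Descend from column `w r + 1`. Where the staircase steps, the new corner is a point of equal
ranks, and by `RankSmooth.staircase` so is the old one; `y` therefore has the ranks of `w` at both.
-/
theorem RankSmooth.stair_add_rkN_eq {w x y : Perm (Fin n)} (hs : RankSmooth w x) {r : Fin n}
    (hr : ∀ u < r, x u = w u) (hlt : x r < w r)
    (hy : ∀ a c : ℕ, x r < c → rkN x a c = rkN w a c → rkN y a c = rkN w a c) {c : ℕ}
    (hc : x r < c) (hcw : c ≤ w r + 1) :
    stair w x r y c + rkN y (cut w x r c) c = stair w x r w c + rkN w (cut w x r c) c := by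
  obtain ⟨d, hd⟩ : ∃ d, c + d = w r + 1 := ⟨_, Nat.add_sub_of_le hcw⟩
  rw [Fin.lt_def] at hlt
  induction d generalizing c with
  | zero =>
    obtain rfl : c = w r + 1 := by omega
    rw [stair_top, stair_top, cut_top hr hlt, hy _ _ (by omega)
      (rkN_row_succ_eq hr (by omega))]
  | succ d ih =>
    have h1 := ih (c := c + 1) (by omega) (by omega) (by omega)
    have g1 := stair_add_rkN (x := x) (r := r) (w := w) y (show c ≤ w r by omega)
    have g2 := stair_add_rkN (x := x) (r := r) (w := w) w (show c ≤ w r by omega)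
    rcases cut_succ (w := w) (x := x) (r := r) hc with h | h
    · rw [h] at h1
      omega
    · have h2 := (hs.staircase hr hlt).1 c hc (by omega)
      have h3 := hy _ _ (by omega) h
      have h4 := hy (cut w x r c) (c + 1) (by omega) (by omega)
      omega

end RowCount

/-! ### Raising `y` in the first differing row, and the induction for tightness. -/

section Tight

variable {n : ℕ}

/-- In a smooth pair, the first differing row of `x` can be raised to the value of `y`, when `y`
has the ranks of `w` wherever those of `x` and `w` agree. -/
theorem RankSmooth.exists_raising {w x y : Perm (Fin n)} (hs : RankSmooth w x) {r : Fin n}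
    (hr : ∀ u < r, x u = w u) (hry : ∀ u < r, y u = w u) (hxy : x r ≤ y r) (hyw : y r ≤ w r)
    (hy : ∀ a c : ℕ, x r < c → rkN x a c = rkN w a c → rkN y a c = rkN w a c) :
    ∃ v, RankSmooth w v ∧ RankLE x v ∧ (∀ u < r, v u = w u) ∧ v r = y r ∧
      ∀ a c : ℕ, v r < c → rkN v a c = rkN w a c → rkN y a c = rkN w a c := by
  induction h : (y r : ℕ) - x r using Nat.strong_induction_on generalizing x with
  | _ m ih =>
    rcases eq_or_lt_of_le hxy with heq | hlt
    · exact ⟨x, hs, fun a c => le_rfl, hr, heq, hy⟩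
    · have hrxy : ∀ u < r, x u = y u := fun u hu => (hr u hu).trans (hry u hu).symm
      obtain ⟨k, ⟨hk1, hk2, hk3⟩, hmin⟩ :=
        exists_first (P := fun k => r < k ∧ x r < x k ∧ x k ≤ y r) ⟨x.symm (y r), by
          have h1 : r ≤ x.symm (y r) := le_of_apply_eq_of_agree hrxy le_rfl (by simp)
          refine ⟨lt_of_le_of_ne h1 ?_, by simpa using hlt, by simp⟩
          intro e
          rw [eq_symm_apply] at e
          exact hlt.ne e⟩
      rw [Fin.le_def] at hk3 hyw
      have hcov : RowCover w x r k := by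
        refine ⟨hr, hk1, hk2, fun u h1 h2 h3 h4 => hmin u h2 ⟨h1, h3, by
          rw [Fin.lt_def] at h4; rw [Fin.le_def]; omega⟩, fun a c h1 h2 h3 h4 => ?_⟩
        -- Equal ranks at `(a, c)` would propagate to column `y r + 1`, since `x` has no more points
        -- than `w` in between. Then `y` would have as many points there as `x`, but it has row `r`
        -- in addition.
        refine lt_of_le_of_ne (hs.rankLE a c) fun e => ?_
        have e1 := rkN_add_band x a (show c ≤ (y r : ℕ) + 1 by omega)
        have e2 := rkN_add_band w a (show c ≤ (y r : ℕ) + 1 by omega)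
        have e3 := rkN_add_band y a (show c ≤ (y r : ℕ) + 1 by omega)
        have hx : ∀ u : Fin n, (u : ℕ) < a ∧ c ≤ x u ∧ (x u : ℕ) < y r + 1 → u < r := by
          intro u hu
          rcases lt_trichotomy u r with h | rfl | h
          · exact h
          · omega
          · exact (hmin u (by rw [Fin.lt_def]; omega)
              ⟨h, by rw [Fin.lt_def]; omega, by rw [Fin.le_def]; omega⟩).elim
        have e4 : band x a c (y r + 1) ≤ band w a c (y r + 1) :=
          card_filter_le_of_imp fun u hu => by rw [← hr u (hx u hu)]; exact hu
        have e5 : band x a c (y r + 1) + 1 ≤ band y a c (y r + 1) :=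
          card_filter_lt_of_imp (fun u hu => by rw [← hrxy u (hx u hu)]; exact hu) r
            ⟨h1, by omega, by omega⟩ (by omega)
        have e6 := hs.rankLE a (y r + 1)
        have e7 := hy a c h3 e.symm
        have e8 := hy a (y r + 1) (by omega) (by omega)
        omega
      have er := mul_swap_apply_left x r k
      obtain ⟨v, h1, h2, h3, h4, h5⟩ := ih ((y r : ℕ) - (x * swap r k) r)
        (by rw [er]; rw [Fin.lt_def] at hk2; omega) (hs.of_rowCover hcov)
        (fun u hu => (mul_swap_apply_of_lt x hk1 hu).trans (hr u hu))
        (by rw [er, Fin.le_def]; exact hk3)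
        (fun a c hc he => hy a c (by rw [er] at hc; rw [Fin.lt_def] at hk2; omega) (by
          rw [← he, rkN_mul_swap_of_notMem x hk1 hk2 (by rw [er] at hc; omega)])) rfl
      exact ⟨v, h1, fun a c => (h2 a c).trans (rkN_mul_swap_le x hk1 hk2 a c), h3, h4, h5⟩

/-- The increasing exchange of the row `r` of `y` with the first row having value in
`(y r, w r]` avoids all points at which the ranks of `x` and `w` agree. -/
theorem RankSmooth.ne_of_mem_step {w x y : Perm (Fin n)} (hs : RankSmooth w x) {r l : Fin n}
    (hr : ∀ u < r, x u = w u) (hry : ∀ u < r, y u = w u) (hxy : x r = y r) (hyw : y r < w r)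
    (hy : ∀ a c : ℕ, x r < c → rkN x a c = rkN w a c → rkN y a c = rkN w a c)
    (hlw : y l ≤ w r) (hmin : ∀ u, r < u → u < l → y r < y u → y u ≤ w r → False)
    {a c : ℕ} (h1 : (r : ℕ) < a) (h2 : a ≤ l) (h3 : y r < c) (h4 : c ≤ y l) :
    rkN x a c ≠ rkN w a c := by
  intro he
  rw [← hxy] at h3
  -- Moving from `c` to a column `d` where equality holds on the staircase itself makes the rank
  -- terms cancel. Above the staircase `y` then has fewer points than `w`, which also has row `r`.
  obtain ⟨g1, d, g2, g3, g4⟩ := cut_mem w x r h3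
  have hcut : cut w x r c ≤ a := cut_le h1 h3 le_rfl he
  have hd : cut w x r d = cut w x r c :=
    le_antisymm (cut_le g1 g2 le_rfl g4) (cut_anti g2 g3)
  have hlt : x r < w r := by rwa [hxy]
  rw [Fin.le_def] at hlw
  have key := hs.stair_add_rkN_eq hr hlt hy g2 (by omega)
  rw [hd, hy _ _ g2 g4] at key
  have : stair w x r y d + 1 ≤ stair w x r w d := by
    refine card_filter_lt_of_imp (fun u hu => ?_) r
      ⟨by omega, le_rfl, (cut_mem w x r hlt).1⟩ ?_
    · obtain ⟨k1, k2, k3⟩ := hu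
      have k4 : cut w x r (y u) ≤ cut w x r d := cut_anti g2 k1
      rcases lt_trichotomy u r with h | rfl | h
      · rw [hry u h] at k1 k2 k3
        exact ⟨k1, k2, k3⟩
      · rw [hxy] at g2
        omega
      · rw [hxy] at g2
        exact (hmin u h (by rw [Fin.lt_def]; omega) (by rw [Fin.lt_def]; omega) k2).elim
    · rw [hxy] at g2
      omega
  omega

/-- Raising the row `r` of `y` to the value of `w` without leaving the set of permutations having
the ranks of `w` wherever those of `x` and `w` agree. -/
theorem RankSmooth.exists_raised {w x y : Perm (Fin n)} (hs : RankSmooth w x) {r : Fin n}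
    (hr : ∀ u < r, x u = w u) (hry : ∀ u < r, y u = w u) (hxy : x r ≤ y r) (hyw : y r ≤ w r)
    (hy : ∀ a c : ℕ, rkN x a c = rkN w a c → rkN y a c = rkN w a c) :
    ∃ z, RankLE y z ∧ (∀ u < r, z u = w u) ∧ z r = w r ∧
      ∀ a c : ℕ, rkN x a c = rkN w a c → rkN z a c = rkN w a c := by
  induction h : (w r : ℕ) - y r using Nat.strong_induction_on generalizing y with
  | _ m ih =>
    rcases eq_or_lt_of_le hyw with heq | hlt
    · exact ⟨y, fun a c => le_rfl, hry, heq, hy⟩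
    · obtain ⟨l, ⟨hl1, hl2, hl3⟩, hmin⟩ :=
        exists_first (P := fun l => r < l ∧ y r < y l ∧ y l ≤ w r) ⟨y.symm (w r), by
          have h1 : r ≤ y.symm (w r) := le_of_apply_eq_of_agree hry le_rfl (by simp)
          refine ⟨lt_of_le_of_ne h1 ?_, by simpa using hlt, by simp⟩
          intro e
          rw [eq_symm_apply] at e
          exact hlt.ne e⟩
      -- Replacing `x` by `v` makes row `r` agree with `y`. As `v` lies between `x` and `w`, its
      -- level set contains that of `x`.
      obtain ⟨v, v1, v2, v3, v4, v5⟩ := hs.exists_raising hr hry hxy hyw (fun a c _ => hy a c)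
      have er := mul_swap_apply_left y r l
      obtain ⟨z, z1, z2, z3, z4⟩ := ih ((w r : ℕ) - (y * swap r l) r)
        (by rw [er]; rw [Fin.lt_def] at hl2; rw [Fin.le_def] at hl3; omega)
        (fun u hu => (mul_swap_apply_of_lt y hl1 hu).trans (hry u hu))
        (by rw [er]; exact hxy.trans hl2.le) (by rw [er]; exact hl3)
        (fun a c he => by
          rw [← hy a c he]
          refine rkN_mul_swap_of_notMem y hl1 hl2 ?_
          rintro ⟨h1, h2, h3, h4⟩
          refine v1.ne_of_mem_step v3 hry v4 hlt v5 hl3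
            (fun u k1 k2 k3 k4 => hmin u k2 ⟨k1, k3, k4⟩) h1 h2 h3 h4 ?_
          exact le_antisymm ((v2 a c).trans he.le) (v1.rankLE a c)) rfl
      exact ⟨z, fun a c => (z1 a c).trans (rkN_mul_swap_le y hl1 hl2 a c), z2, z3, z4⟩

/-- When `y` agrees with `w` in the first differing row, it has the ranks of `w` also at the points
where the ranks of `w` and of the cover of `x` in that row newly agree. -/
theorem RankSmooth.rkN_eq_of_mem_cover {w x y : Perm (Fin n)} (hs : RankSmooth w x) {r k : Fin n}
    (hr : ∀ u < r, x u = w u) (hry : ∀ u < r, y u = w u) (hyw : y r = w r) (hlt : x r < w r)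
    (hy : ∀ a c : ℕ, rkN x a c = rkN w a c → rkN y a c = rkN w a c)
    (hrk : r < k) (hkw : x k ≤ w r)
    (hmin : ∀ u, r < u → u < k → x r < x u → x u ≤ w r → False)
    (hgap : ∀ a c : ℕ, r < a → a ≤ k → x r < c → c ≤ w r → rkN w a c < rkN x a c)
    {a c : ℕ} (h1 : (r : ℕ) < a) (h2 : a ≤ k) (h3 : x r < c) (h4 : c ≤ x k)
    (h5 : rkN x a c = rkN w a c + 1) : rkN y a c = rkN w a c := by
  have hle := hs.rankLE
  have hlt' := Fin.lt_def.1 hlt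
  have hkw' := Fin.le_def.1 hkw
  have ex := rkN_add_band x a (show c ≤ (w r : ℕ) + 1 by omega)
  have ew := rkN_add_band w a (show c ≤ (w r : ℕ) + 1 by omega)
  have ey := rkN_add_band y a (show c ≤ (w r : ℕ) + 1 by omega)
  have hxr : ∀ u : Fin n, (u : ℕ) < a ∧ c ≤ x u ∧ (x u : ℕ) < w r + 1 → u < r := by
    intro u hu
    rcases lt_trichotomy u r with h | rfl | h
    · exact h
    · omega
    · exact (hmin u h (by rw [Fin.lt_def]; omega) (by rw [Fin.lt_def]; omega)
        (by rw [Fin.le_def]; omega)).elim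
  have b1 : band x a c (w r + 1) + 1 ≤ band w a c (w r + 1) :=
    card_filter_lt_of_imp (fun u hu => by rw [← hr u (hxr u hu)]; exact hu) r
      ⟨h1, by omega, by omega⟩ (by omega)
  have b2 : band x a c (w r + 1) + 1 ≤ band y a c (w r + 1) :=
    card_filter_lt_of_imp (fun u hu => by
      rw [hry u (hxr u hu), ← hr u (hxr u hu)]; exact hu) r
      ⟨h1, by omega, by omega⟩ (by omega)
  have d1 : rkN x a (w r + 1) = rkN w a (w r + 1) := by
    have := hle a (w r + 1)
    omega
  have d2 := hy _ _ d1
  by_contra hne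
  have hw2 : ∀ u : Fin n, r < u → (u : ℕ) < a → c ≤ w u → w u ≤ w r → False := by
    intro u k1 k2 k3 k4
    have := card_filter_add_two_le (P := fun u : Fin n => (u : ℕ) < a ∧ c ≤ x u ∧
      (x u : ℕ) < w r + 1) (Q := fun u : Fin n => (u : ℕ) < a ∧ c ≤ w u ∧ (w u : ℕ) < w r + 1)
      (fun u hu => by rw [← hr u (hxr u hu)]; exact hu) r u ⟨h1, by omega, by omega⟩
      ⟨k2, k3, by rw [Fin.le_def] at k4; omega⟩ (by omega)
      (fun hu => lt_asymm k1 (hxr u hu)) k1.ne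
    unfold band at ew ex
    omega
  -- With equal ranks in column `w r + 1` and different ones in column `c`, `y` must have more
  -- points than `w` in between, hence one in a row after `r`.
  obtain ⟨b, hb1, hb2, hb3, hb4⟩ : ∃ b : Fin n, r < b ∧ (b : ℕ) < a ∧ c ≤ y b ∧ y b ≤ w r := by
    by_contra! hno
    have : band y a c (w r + 1) ≤ band w a c (w r + 1) := by
      refine card_filter_le_of_imp fun u hu => ?_
      rcases lt_trichotomy u r with h | rfl | h
      · rw [← hry u h]
        exact hu
      · rw [hyw] at hu
        exact hu
      · have := hno u h hu.1 hu.2.1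
        rw [Fin.lt_def] at this
        omega
    omega
  have hcut : ∀ d : ℕ, x r < d → d ≤ w r → k < cut w x r d := by
    intro d k1 k2
    by_contra! hk
    obtain ⟨g1, e, g2, g3, g4⟩ := cut_mem w x r k1
    exact (hgap _ e g1 hk g2 (by omega)).ne' g4
  -- If such an `s` exists, it is a record lying at or after row `a`, so `w` has no points in rows
  -- `(r, a)` with values from `x r` to `w r`. Equality of ranks then extends to column `x r`, and
  -- `b` is one point too many for `y`.
  by_cases hrec : ∃ s, r < s ∧ c ≤ w s ∧ w s < w r ∧ (s : ℕ) < cut w x r (w s)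
  · obtain ⟨s, s1, s2, s3, s4⟩ := hrec
    have hs' := (hs.staircase hr hlt).2 s s1 (by rw [Fin.lt_def]; omega) s3 s4
    simp only [records, mem_filter, mem_univ, true_and] at hs'
    have hsa : a ≤ s := by
      by_contra! h
      exact hw2 s s1 h s2 s3.le
    have hw3 : ∀ u : Fin n, r < u → (u : ℕ) < a → x r ≤ w u → w u ≤ w r → False := by
      intro u k1 k2 k3 k4
      by_cases hc : c ≤ w u
      · exact hw2 u k1 k2 hc k4
      · exact hs'.2.2.2 u k1 (by rw [Fin.lt_def]; omega) k3 (by rw [Fin.lt_def]; omega)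
    have fx := rkN_add_band x a (show (x r : ℕ) ≤ w r + 1 by omega)
    have fw := rkN_add_band w a (show (x r : ℕ) ≤ w r + 1 by omega)
    have fy := rkN_add_band y a (show (x r : ℕ) ≤ w r + 1 by omega)
    have hwr : ∀ u : Fin n, (u : ℕ) < a ∧ (x r : ℕ) ≤ w u ∧ (w u : ℕ) < w r + 1 → u ≤ r := by
      intro u hu
      by_contra! h
      exact hw3 u h hu.1 hu.2.1 (by rw [Fin.le_def]; omega)
    have c1 : band w a (x r) (w r + 1) ≤ band x a (x r) (w r + 1) := by
      refine card_filter_le_of_imp fun u hu => ?_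
      rcases lt_or_eq_of_le (hwr u hu) with h | rfl
      · rw [hr u h]
        exact hu
      · exact ⟨h1, le_rfl, by omega⟩
    have c2 : band w a (x r) (w r + 1) + 1 ≤ band y a (x r) (w r + 1) := by
      refine card_filter_lt_of_imp (fun u hu => ?_) b
        ⟨hb2, by omega, by rw [Fin.le_def] at hb4; omega⟩ (fun hu => ?_)
      · rcases lt_or_eq_of_le (hwr u hu) with h | rfl
        · rw [hry u h]
          exact hu
        · rw [hyw]
          exact hu
      · exact absurd (hwr b hu) (not_le.2 hb1)
    have c3 := hy a (x r) (by have := hle a (x r); omega)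
    omega
  -- Otherwise `x` has at least as many points as `w` above the staircase, row `k` replacing row
  -- `r`. The conserved sum forces equal ranks at `(cut w x r c, c)`, and the extra point `b` of `y`
  -- violates the same sum.
  · have hws : ∀ u : Fin n, c ≤ w u ∧ w u ≤ w r ∧ (u : ℕ) < cut w x r (w u) → u ≤ r := by
      intro u hu
      by_contra! h
      refine hrec ⟨u, h, hu.1, lt_of_le_of_ne hu.2.1 ?_, hu.2.2⟩
      exact fun e => h.ne' (w.injective e)
    have s1 : stair w x r w c ≤ stair w x r x c := by
      have t1 : stair w x r w c ≤ #{u : Fin n | (u < r ∧ c ≤ w u ∧ w u ≤ w r) ∨ u = r} :=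
        card_filter_le_of_imp fun u hu => by
          rcases lt_or_eq_of_le (hws u hu) with h | h
          · exact Or.inl ⟨h, hu.1, hu.2.1⟩
          · exact Or.inr h
      have t2 : #{u : Fin n | (u < r ∧ c ≤ w u ∧ w u ≤ w r) ∨ u = r} ≤
          #{u : Fin n | u < r ∧ c ≤ w u ∧ w u ≤ w r} + 1 := by
        rw [filter_or]
        refine (card_union_le _ _).trans (Nat.add_le_add_left ?_ _)
        exact card_le_one.2 fun u hu v hv => by
          rw [(mem_filter.1 hu).2, (mem_filter.1 hv).2]
      have t3 : #{u : Fin n | u < r ∧ c ≤ w u ∧ w u ≤ w r} + 1 ≤ stair w x r x c := by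
        refine card_filter_lt_of_imp (fun u hu => ?_) k ⟨h4, hkw, hcut _ (by omega) hkw'⟩
          (fun hu => lt_asymm hrk hu.1)
        rw [hr u hu.1]
        have := hcut (w u) (by omega) (Fin.le_def.1 hu.2.2)
        exact ⟨hu.2.1, hu.2.2, by have := hu.1; omega⟩
      omega
    have s2 : stair w x r w c + 1 ≤ stair w x r y c := by
      refine card_filter_lt_of_imp (fun u hu => ?_) b
        ⟨hb3, hb4, by have := hcut (y b) (by omega) (Fin.le_def.1 hb4); omega⟩
        (fun hu => not_le.2 hb1 (hws b hu))
      rcases lt_or_eq_of_le (hws u hu) with h | rfl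
      · rw [hry u h]
        exact hu
      · rw [hyw]
        exact hu
    have e1 := hs.stair_add_rkN_eq hr hlt (fun a c _ he => he) h3 (by omega)
    have e2 := hs.stair_add_rkN_eq hr hlt (fun a c _ => hy a c) h3 (by omega)
    have e3 := hle (cut w x r c) c
    have e4 := hy (cut w x r c) c (by omega)
    omega

/-- Tightness of smooth pairs, in terms of ranks. -/
theorem RankSmooth.rankLE_of_rkN_eq {w x y : Perm (Fin n)} (hs : RankSmooth w x)
    (hy : ∀ a c : ℕ, rkN x a c = rkN w a c → rkN y a c = rkN w a c) : RankLE y w := by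
  induction h : (∑ p : Fin n, (p : ℕ)) - length x using Nat.strong_induction_on
    generalizing x y with
  | _ m ih =>
    by_cases hne : x = w
    · subst hne
      exact fun a c => (hy a c rfl).ge
    obtain ⟨r, h1, hr⟩ := exists_first_ne hne
    have hlt := lt_of_le_of_ne (hs.rankLE.apply_le hr) h1
    obtain ⟨k, hc, hkw, hmin, hgap⟩ := exists_rowCover hs.rankLE hr hlt
    have hrow : ∀ a c : ℕ, a ≤ r → rkN y a c = rkN w a c := fun a c ha =>
      hy a c (rkN_congr (r := r) hr ha c)
    have hry : ∀ u < r, y u = w u := by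
      by_contra! hcon
      obtain ⟨u, ⟨hu1, hu2⟩, hu3⟩ := exists_first (P := fun u => u < r ∧ y u ≠ w u) hcon
      have hu4 : ∀ v < u, y v = w v := fun v hv => by
        by_contra hh
        exact hu3 v hv ⟨hv.trans hu1, hh⟩
      rw [Fin.lt_def] at hu1
      exact hu2 (le_antisymm (apply_le_of_rkN_le hu4 (hrow _ _ hu1).ge)
        (apply_le_of_rkN_le (fun v hv => (hu4 v hv).symm) (hrow _ _ hu1).le))
    rw [Fin.lt_def] at hlt
    have hxy : x r ≤ y r := by
      by_contra! hcon
      rw [Fin.lt_def] at hcon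
      have h3 : rkN x (r + 1) (y r + 1) = rkN w (r + 1) (y r + 1) := rkN_row_succ_eq hr (by omega)
      have := apply_le_of_rkN_le (x := x) (w := y) (r := r)
        (fun u hu => (hr u hu).trans (hry u hu).symm) ((hy _ _ h3).trans h3.symm).le
      rw [Fin.le_def] at this
      omega
    have hyw : y r ≤ w r :=
      apply_le_of_rkN_le hry (hy _ _ (rkN_row_succ_eq hr (by omega))).ge
    obtain ⟨z, z1, z2, z3, z4⟩ := hs.exists_raised hr hry hxy hyw hy
    have hzw : RankLE z w := by
      have h3 := hc.length_eq
      have h4 := length_le (x * swap r k)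
      refine ih _ (by omega) (hs.of_rowCover hc) (fun a c he => ?_) rfl
      -- Points of the level set of the cover are new only inside the exchanged rectangle.
      by_cases hq : (r : ℕ) < a ∧ a ≤ k ∧ (x r : ℕ) < c ∧ c ≤ x k
      · obtain ⟨q1, q2, q3, q4⟩ := hq
        have := rkN_mul_swap_of_mem x hc.lt hc.val_lt q1 q2 q3 q4
        exact hs.rkN_eq_of_mem_cover hr z2 z3 hlt z4 hc.lt hkw hmin hgap q1 q2 q3 q4 (by omega)
      · rw [rkN_mul_swap_of_notMem x hc.lt hc.val_lt hq] at he
        exact z4 a c he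
    exact fun a c => (hzw a c).trans (z1 a c)

end Tight

end SchubertTight

theorem theorem2p2 (n : ℕ) (w x : Equiv.Perm (Fin n)) (hxw : SchubertTight.BruhatLE x w)
    (hsmooth : SchubertTight.IsSmoothPair w x) : SchubertTight.IsTightPair w x := by
  have hle := hxw.rankLE
  have hs : SchubertTight.RankSmooth w x := by
    refine ⟨hle, ?_⟩
    unfold SchubertTight.IsSmoothPair at hsmooth
    rw [SchubertTight.ncard_reflectionSet hle] at hsmooth
    omega
  intro y hy
  refine (hs.rankLE_of_rkN_eq fun a c he => ?_).bruhatLE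
  rw [SchubertTight.rkN_eq_rk, SchubertTight.rkN_eq_rk] at he ⊢
  exact hy _ he
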